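/- Let $\mathcal X$ be a separable real Hilbert space and let $\mu=N(0,\mathcal K)$ be a centered Gaussian measure on $\mathcal X$ with covariance operator $\mathcal K$, i.e. a Borel probability measure with mean $0$ whose image under every bounded linear functional is a (possibly degenerate) Gaussian measure on $\mathbb R$. Let $\mathcal K^{1/2}$ be the positive square root of $\mathcal K$, and let $\mathcal H(\mu):=\mathcal K^{1/2}\mathcal X$ be the Cameron--Martin space of $\mu$, with norm $\|u\|_{\mathcal H(\mu)}:=\|\mathcal K^{-1/2}u\|_{\mathcal X}$; here $\mathcal K^{-1/2}u$ is the unique $x\in\mathcal X$ orthogonal to $\ker\mathcal K^{1/2}$ with $\mathcal K^{1/2}x=u$ (the only solution $x$ if $\mathcal K$ is injective). Let $\phi=(\phi_1,\dots,\phi_N)$ with $\phi_i\in\mathcal X^\ast$, write $\phi(u):=(\phi_1(u),\dots,\phi_N(u))\in\mathbb R^N$, and let $F:\mathbb R^N\to\mathbb R^M$ be locally Lipschitz: for every $r>0$ there is $L(r)>0$ such that $|F(z_1)-F(z_2)|\le L(r)\,|z_1-z_2|$ for all $z_1,z_2$ in the ball of radius $r$ about $0$, where $|\cdot|$ is the Euclidean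 norm. For $y\in\mathbb R^M$ and $\beta>0$ let $\mu^y_\beta$ be the probability measure on $\mathcal X$ given by $$\frac{\mathrm d\mu^y_\beta}{\mathrm d\mu}(u)=\frac1{\omega_\beta(y)}\exp\Big(-\frac1{2\beta^2}|F(\phi(u))-y|^2\Big),\qquad \omega_\beta(y):=\int_{\mathcal X}\exp\Big(-\frac1{2\beta^2}|F(\phi(v))-y|^2\Big)\,\mu(\mathrm dv),$$ and let $J^y_\beta:\mathcal X\to[0,\infty]$ be the Onsager--Machlup functional $$J^y_\beta(u):=\begin{cases}\dfrac1{2\beta^2}|F(\phi(u))-y|^2+\dfrac12\|u\|^2_{\mathcal H(\mu)},&u\in\mathcal H(\mu),\\[1ex]+\infty,&u\in\mathcal X\setminus\mathcal H(\mu).\end{cases}$$ Then a point $u^\dagger\in\mathcal X$ is a MAP estimator (mode) of $\mu^y_\beta$, meaning that $$\lim_{r\downarrow0}\frac{\mu^y_\beta(B_r(u^\dagger))}{\sup_{u\in\mathcal X}\mu^y_\beta(B_r(u))}=1,$$ where $B_r(u)$ is the open ball in $\mathcal X$ of radius $r$ about $u$, if and only if $u^\dagger$ is a (global) minimizer of $J^y_\beta$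 over $\mathcal X$. -/

import Mathlib

open MeasureTheory ProbabilityTheory Filter Topology
open scoped ENNReal InnerProductSpace

namespace GaussianMAP

section PositiveSqrt

variable {X : Type*} [NormedAddCommGroup X] [InnerProductSpace ℝ X] [CompleteSpace X]

/-- If `‖A‖ ≤ 1`, the equation `B = (A + B ^ 2) / 2` has a solution in the closed unit ball,
obtained as the limit of the iteration started at `0`; it commutes with everything that commutes
with `A`, and it is self-adjoint when `A` is. -/
lemma exists_half_add_sq (A : X →L[ℝ] X) (hA : ‖A‖ ≤ 1) (hsa : IsSelfAdjoint A) :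
    ∃ B : X →L[ℝ] X, ‖B‖ ≤ 1 ∧ IsSelfAdjoint B ∧ B + B = A + B * B ∧
      ∀ T : X →L[ℝ] X, Commute T A → Commute T B := by
  obtain ⟨B, hB0, hB⟩ : ∃ B : ℕ → X →L[ℝ] X, B 0 = 0 ∧
      ∀ n, B (n + 1) = (1 / 2 : ℝ) • (A + B n * B n) :=
    ⟨fun n => Nat.rec 0 (fun _ C => (1 / 2 : ℝ) • (A + C * C)) n, rfl, fun _ => rfl⟩
  obtain ⟨b, hb0, hb⟩ : ∃ b : ℕ → ℝ, b 0 = 0 ∧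
      ∀ n, b (n + 1) = (1 / 2 : ℝ) * (1 + b n * b n) :=
    ⟨fun n => Nat.rec 0 (fun _ c => (1 / 2 : ℝ) * (1 + c * c)) n, rfl, fun _ => rfl⟩
  have hbnn : ∀ n, 0 ≤ b n ∧ b n ≤ 1 := by
    intro n
    induction n with
    | zero => simp [hb0]
    | succ n ih =>
      rw [hb]
      constructor <;> nlinarith [ih.1, ih.2]
  have hBb : ∀ n, ‖B n‖ ≤ b n := by
    intro n
    induction n with
    | zero => simp [hB0, hb0]
    | succ n ih =>
      rw [hB, hb, norm_smul, Real.norm_of_nonneg (by norm_num)]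
      have h1 : ‖A + B n * B n‖ ≤ ‖A‖ + ‖B n‖ * ‖B n‖ :=
        (norm_add_le _ _).trans (by gcongr; exact norm_mul_le _ _)
      have h2 : ‖B n‖ * ‖B n‖ ≤ b n * b n :=
        mul_le_mul ih ih (norm_nonneg _) (hbnn n).1
      linarith
  have hdiff : ∀ n, ‖B (n + 1) - B n‖ ≤ b (n + 1) - b n := by
    intro n
    induction n with
    | zero =>
      have := hBb 1
      simpa [hB0, hb0] using this
    | succ n ih =>
      have e : B (n + 1 + 1) - B (n + 1)
          = (1 / 2 : ℝ) • (B (n + 1) * (B (n + 1) - B n) + (B (n + 1) - B n) * B n) := by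
        have e0 : B (n + 1 + 1) - B (n + 1)
            = (1 / 2 : ℝ) • (A + B (n + 1) * B (n + 1)) - (1 / 2 : ℝ) • (A + B n * B n) := by
          rw [← hB, ← hB]
        rw [e0, ← smul_sub]
        congr 1
        generalize B (n + 1) = C
        noncomm_ring
      have e' : b (n + 1 + 1) - b (n + 1)
          = (1 / 2 : ℝ) * (b (n + 1) * (b (n + 1) - b n) + (b (n + 1) - b n) * b n) := by
        have e0 : b (n + 1 + 1) - b (n + 1)
            = (1 / 2 : ℝ) * (1 + b (n + 1) * b (n + 1)) - (1 / 2 : ℝ) * (1 + b n * b n) := by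
          rw [← hb, ← hb]
        rw [e0]
        ring
      rw [e, e', norm_smul, Real.norm_of_nonneg (by norm_num)]
      have hd : 0 ≤ b (n + 1) - b n := (norm_nonneg _).trans ih
      have h1 := norm_add_le (B (n + 1) * (B (n + 1) - B n)) ((B (n + 1) - B n) * B n)
      have h2 := norm_mul_le (B (n + 1)) (B (n + 1) - B n)
      have h3 := norm_mul_le (B (n + 1) - B n) (B n)
      have h4 := mul_le_mul (hBb (n + 1)) ih (norm_nonneg _) (hbnn (n + 1)).1
      have h5 := mul_le_mul ih (hBb n) (norm_nonneg _) hd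
      linarith
  have hsum : Summable fun n => b (n + 1) - b n := by
    refine summable_of_sum_range_le (c := 1) (fun n => (norm_nonneg _).trans (hdiff n)) ?_
    intro n
    rw [Finset.sum_range_sub, hb0, sub_zero]
    exact (hbnn n).2
  have hcau : CauchySeq B := by
    refine cauchySeq_of_dist_le_of_summable _ (fun n => ?_) hsum
    rw [dist_eq_norm, norm_sub_rev]
    exact hdiff n
  obtain ⟨L, hL⟩ := cauchySeq_tendsto_of_complete hcau
  have hlim : Tendsto (fun n => B (n + 1)) atTop (𝓝 ((1 / 2 : ℝ) • (A + L * L))) := by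
    simp only [hB]
    exact (tendsto_const_nhds.add (hL.mul hL)).const_smul _
  have hfix : L = (1 / 2 : ℝ) • (A + L * L) :=
    tendsto_nhds_unique ((tendsto_add_atTop_iff_nat 1).2 hL) hlim
  refine ⟨L, ?_, ?_, ?_, ?_⟩
  · exact le_of_tendsto hL.norm (Eventually.of_forall fun n => (hBb n).trans (hbnn n).2)
  · have hn : ∀ n, IsSelfAdjoint (B n) := by
      intro n
      induction n with
      | zero => rw [hB0]; exact IsSelfAdjoint.zero _
      | succ n ih =>
        rw [hB]
        refine IsSelfAdjoint.smul (IsSelfAdjoint.all _) (hsa.add ?_)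
        rw [← pow_two]
        exact ih.pow 2
    have h1 : Tendsto (fun n => star (B n)) atTop (𝓝 (star L)) := hL.star
    simp only [fun n => (hn n).star_eq] at h1
    exact tendsto_nhds_unique h1 hL
  · have : L + L = (2 : ℝ) • L := (two_smul ℝ L).symm
    rw [this]
    nth_rewrite 1 [hfix]
    rw [smul_smul]
    norm_num
  · intro T hT
    have hn : ∀ n, Commute T (B n) := by
      intro n
      induction n with
      | zero => rw [hB0]; exact Commute.zero_right _
      | succ n ih =>
        rw [hB]
        exact (hT.add_right (ih.mul_right ih)).smul_right _
    have h1 : Tendsto (fun n => T * B n) atTop (𝓝 (T * L)) := tendsto_const_nhds.mul hL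
    have h2 : Tendsto (fun n => B n * T) atTop (𝓝 (L * T)) := hL.mul tendsto_const_nhds
    simp only [fun n => (hn n).eq] at h1
    exact tendsto_nhds_unique h1 h2

/-- A positive bounded operator on a real Hilbert space has a unique positive square root. -/
theorem existsUnique_posSqrt (K : X →L[ℝ] X) (hK : K.IsPositive) :
    ∃! S : X →L[ℝ] X, S.IsPositive ∧ S * S = K := by
  have hex : ∃ S : X →L[ℝ] X, S.IsPositive ∧ S * S = K ∧
      ∀ T : X →L[ℝ] X, Commute T K → Commute T S := by
    rcases eq_or_ne K 0 with rfl | hK0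
    · exact ⟨0, ContinuousLinearMap.isPositive_zero, by simp, fun T _ => Commute.zero_right T⟩
    have hc : 0 < ‖K‖ := norm_pos_iff.2 hK0
    have hAsa : IsSelfAdjoint (1 - ‖K‖⁻¹ • K) :=
      (IsSelfAdjoint.one _).sub (IsSelfAdjoint.smul (IsSelfAdjoint.all _) hK.isSelfAdjoint)
    have hA : ‖1 - ‖K‖⁻¹ • K‖ ≤ 1 := by
      rw [ContinuousLinearMap.norm_eq_iSup_rayleighQuotient _
        (ContinuousLinearMap.isSelfAdjoint_iff_isSymmetric.1 hAsa)]
      refine ciSup_le fun x => ?_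
      rw [ContinuousLinearMap.rayleighQuotient, abs_div, abs_of_nonneg (sq_nonneg ‖x‖)]
      refine div_le_one_of_le₀ ?_ (sq_nonneg _)
      have h1 : (1 - ‖K‖⁻¹ • K).reApplyInnerSelf x = ‖x‖ ^ 2 - ‖K‖⁻¹ * ⟪K x, x⟫_ℝ := by
        simp [ContinuousLinearMap.reApplyInnerSelf_apply, inner_sub_left, inner_smul_left]
      have h2 : 0 ≤ ⟪K x, x⟫_ℝ := hK.inner_nonneg_left x
      have h3 : ⟪K x, x⟫_ℝ ≤ ‖K‖ * ‖x‖ ^ 2 := by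
        have := (real_inner_le_norm (K x) x).trans
          (mul_le_mul_of_nonneg_right (K.le_opNorm x) (norm_nonneg x))
        nlinarith
      have h4 : ‖K‖⁻¹ * ⟪K x, x⟫_ℝ ≤ ‖x‖ ^ 2 := by
        rwa [inv_mul_le_iff₀ hc]
      have h5 : 0 ≤ ‖K‖⁻¹ * ⟪K x, x⟫_ℝ := by positivity
      rw [h1, abs_le]
      constructor <;> nlinarith [sq_nonneg ‖x‖]
    obtain ⟨B, hB1, hBsa, hBeq, hBcomm⟩ := exists_half_add_sq _ hA hAsa
    refine ⟨√‖K‖ • (1 - B), ?_, ?_, ?_⟩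
    · refine ContinuousLinearMap.IsPositive.smul_of_nonneg ?_ (Real.sqrt_nonneg _)
      rw [ContinuousLinearMap.isPositive_iff']
      refine ⟨(IsSelfAdjoint.one _).sub hBsa, fun x => ?_⟩
      have h1 : ⟪B x, x⟫_ℝ ≤ ‖x‖ * ‖x‖ :=
        (real_inner_le_norm (B x) x).trans
          (mul_le_mul_of_nonneg_right
            ((B.le_opNorm x).trans (mul_le_of_le_one_left (norm_nonneg x) hB1)) (norm_nonneg x))
      have h2 : ⟪(1 - B) x, x⟫_ℝ = ‖x‖ * ‖x‖ - ⟪B x, x⟫_ℝ := by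
        simp [inner_sub_left, pow_two]
      rw [h2]
      linarith
    · have h1 : (1 - B) * (1 - B) = ‖K‖⁻¹ • K := by
        have : (1 - B) * (1 - B) = 1 - (B + B) + B * B := by noncomm_ring
        rw [this, hBeq]
        abel
      rw [smul_mul_smul_comm, h1, Real.mul_self_sqrt hc.le, smul_smul, mul_inv_cancel₀ hc.ne',
        one_smul]
    · intro T hT
      refine Commute.smul_right ?_ _
      refine (Commute.one_right T).sub_right (hBcomm T ?_)
      exact (Commute.one_right T).sub_right (hT.smul_right _)
  obtain ⟨S, hS, hSS, hScomm⟩ := hex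
  refine ⟨S, ⟨hS, hSS⟩, ?_⟩
  rintro T ⟨hT, hTT⟩
  have hTS : T * S = S * T := hScomm T (by rw [← hTT]; exact (Commute.refl T).mul_right rfl)
  have hDsa : IsSelfAdjoint (T - S) := hT.isSelfAdjoint.sub hS.isSelfAdjoint
  have hDsymm : ∀ x y, ⟪(T - S) x, y⟫_ℝ = ⟪x, (T - S) y⟫_ℝ :=
    ContinuousLinearMap.isSelfAdjoint_iff_isSymmetric.1 hDsa
  have hD0 : ∀ x, ⟪(T - S) ((T - S) x), (T - S) x⟫_ℝ = 0 := by
    intro x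
    have h1 : (T + S) * (T - S) = 0 := by
      have : (T + S) * (T - S) = T * T - S * S + (S * T - T * S) := by noncomm_ring
      rw [this, hTT, hSS, hTS]
      simp
    have h2 : T ((T - S) x) + S ((T - S) x) = 0 := by
      simpa using! congrArg (fun L : X →L[ℝ] X => L x) h1
    have h3 : ⟪T ((T - S) x), (T - S) x⟫_ℝ + ⟪S ((T - S) x), (T - S) x⟫_ℝ = 0 := by
      rw [← inner_add_left, h2, inner_zero_left]
    have h4 := hT.inner_nonneg_left ((T - S) x)
    have h5 := hS.inner_nonneg_left ((T - S) x)
    have h6 : ⟪(T - S) ((T - S) x), (T - S) x⟫_ℝ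
        = ⟪T ((T - S) x), (T - S) x⟫_ℝ - ⟪S ((T - S) x), (T - S) x⟫_ℝ := by
      rw [← inner_sub_left]; rfl
    rw [h6]
    linarith
  have hcube : (((T - S) * (T - S) * (T - S) : X →L[ℝ] X) : X →ₗ[ℝ] X) = 0 := by
    refine (LinearMap.IsSymmetric.inner_map_self_eq_zero ?_).1 fun x => ?_
    · intro x y
      change ⟪(T - S) ((T - S) ((T - S) x)), y⟫_ℝ = ⟪x, (T - S) ((T - S) ((T - S) y))⟫_ℝ
      rw [hDsymm, hDsymm, hDsymm]
    · change ⟪(T - S) ((T - S) ((T - S) x)), x⟫_ℝ = 0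
      rw [hDsymm]
      exact hD0 x
  have hcube' : ∀ x, (T - S) ((T - S) ((T - S) x)) = 0 := fun x => LinearMap.congr_fun hcube x
  have hsq : ∀ x, (T - S) ((T - S) x) = 0 := by
    intro x
    rw [← inner_self_eq_zero (𝕜 := ℝ), hDsymm, hcube', inner_zero_right]
  have hone : ∀ x, (T - S) x = 0 := by
    intro x
    rw [← inner_self_eq_zero (𝕜 := ℝ), hDsymm, hsq, inner_zero_right]
  exact sub_eq_zero.1 (ContinuousLinearMap.ext hone)

/-- The positive square root `K ^ (1 / 2)` of a positive bounded operator `K`. -/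
noncomputable def posSqrt (K : X →L[ℝ] X) (hK : K.IsPositive) : X →L[ℝ] X :=
  (existsUnique_posSqrt K hK).choose

lemma posSqrt_isPositive (K : X →L[ℝ] X) (hK : K.IsPositive) : (posSqrt K hK).IsPositive :=
  (existsUnique_posSqrt K hK).choose_spec.1.1

lemma posSqrt_mul_self (K : X →L[ℝ] X) (hK : K.IsPositive) :
    posSqrt K hK * posSqrt K hK = K :=
  (existsUnique_posSqrt K hK).choose_spec.1.2

end PositiveSqrt

section CameronMartin

variable {X : Type*} [NormedAddCommGroup X] [InnerProductSpace ℝ X] [CompleteSpace X]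
  [MeasurableSpace X] [BorelSpace X]

/-- The square root `K ^ (1 / 2)` of the covariance operator `K` of `μ`. (Mathlib's
`covarianceOperator` is uncentered, which for a centered measure is the covariance operator.) -/
noncomputable def covSqrt (μ : Measure X) : X →L[ℝ] X :=
  posSqrt (covarianceOperator μ)
    ((ContinuousLinearMap.isPositive_toLinearMap_iff _).1 isPositive_covarianceOperator)

/-- The Cameron-Martin space `H(μ) = K ^ (1 / 2) X` of a centered Gaussian measure `μ = N(0, K)`. -/
noncomputable def cameronMartin (μ : Measure X) : Submodule ℝ X :=
  LinearMap.range (covSqrt μ : X →ₗ[ℝ] X)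

/-- `K ^ (-1 / 2) u` for `u ∈ K ^ (1 / 2) X`: the solution `x` of `K ^ (1 / 2) x = u` which is
orthogonal to the kernel of `K ^ (1 / 2)`, i.e. the only solution if `K` is injective, and the
solution of least norm (pseudo-inverse) in general. It is obtained by projecting any solution, see
`covSqrt_covInvSqrt`, `covInvSqrt_mem` and `covInvSqrt_unique`. -/
noncomputable def covInvSqrt (μ : Measure X) (u : cameronMartin μ) : X :=
  (LinearMap.ker (covSqrt μ : X →ₗ[ℝ] X))ᗮ.starProjection (LinearMap.mem_range.1 u.2).choose

lemma covInvSqrt_mem (μ : Measure X) (u : cameronMartin μ) :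
    covInvSqrt μ u ∈ (LinearMap.ker (covSqrt μ : X →ₗ[ℝ] X))ᗮ :=
  Submodule.starProjection_apply_mem _ _

lemma covSqrt_covInvSqrt (μ : Measure X) (u : cameronMartin μ) :
    covSqrt μ (covInvSqrt μ u) = u := by
  have : CompleteSpace (LinearMap.ker (covSqrt μ : X →ₗ[ℝ] X)) :=
    (covSqrt μ).isClosed_ker.completeSpace_coe
  have h := (LinearMap.mem_range.1 u.2).choose_spec
  set x := (LinearMap.mem_range.1 u.2).choose
  have h1 : x - covInvSqrt μ u ∈ LinearMap.ker (covSqrt μ : X →ₗ[ℝ] X) := by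
    have := Submodule.sub_starProjection_mem_orthogonal
      (K := (LinearMap.ker (covSqrt μ : X →ₗ[ℝ] X))ᗮ) x
    rwa [Submodule.orthogonal_orthogonal] at this
  have h2 : covSqrt μ (x - covInvSqrt μ u) = 0 := h1
  rw [map_sub, sub_eq_zero] at h2
  rw [← h2]
  exact h

lemma covInvSqrt_unique (μ : Measure X) (u : cameronMartin μ) (x : X)
    (hx : x ∈ (LinearMap.ker (covSqrt μ : X →ₗ[ℝ] X))ᗮ) (hxu : covSqrt μ x = u) :
    x = covInvSqrt μ u := by
  have h1 : x - covInvSqrt μ u ∈ LinearMap.ker (covSqrt μ : X →ₗ[ℝ] X) := by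
    change covSqrt μ (x - covInvSqrt μ u) = 0
    rw [map_sub, hxu, covSqrt_covInvSqrt, sub_self]
  have h2 := Submodule.sub_mem _ hx (covInvSqrt_mem μ u)
  exact sub_eq_zero.1 (inner_self_eq_zero (𝕜 := ℝ).1 (h2 _ h1))

/-- The Cameron-Martin norm `‖u‖_{H(μ)} = ‖K ^ (-1 / 2) u‖`. -/
noncomputable def cameronMartinNorm (μ : Measure X) (u : cameronMartin μ) : ℝ :=
  ‖covInvSqrt μ u‖

end CameronMartin

section Posterior

variable {X : Type*} [NormedAddCommGroup X] [InnerProductSpace ℝ X] {N M : ℕ}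

/-- The observation map `G = F ∘ φ`, with `φ = (φ₁, …, φ_N)` a vector of bounded functionals. -/
noncomputable def obsMap (φ : Fin N → StrongDual ℝ X)
    (F : EuclideanSpace ℝ (Fin N) → EuclideanSpace ℝ (Fin M)) (u : X) : EuclideanSpace ℝ (Fin M) :=
  F (WithLp.toLp 2 fun i => φ i u)

/-- The posterior measure: its density with respect to `μ` is `exp (- |F (φ u) - y|² / (2 β²))`
divided by the normalizing constant `∫ exp (- |F (φ v) - y|² / (2 β²)) dμ(v)`. -/
noncomputable def posterior [MeasurableSpace X] (μ : Measure X) (φ : Fin N → StrongDual ℝ X)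
    (F : EuclideanSpace ℝ (Fin N) → EuclideanSpace ℝ (Fin M)) (y : EuclideanSpace ℝ (Fin M))
    (β : ℝ) : Measure X :=
  μ.withDensity fun u => ENNReal.ofReal
    (Real.exp (-(1 / (2 * β ^ 2)) * ‖obsMap φ F u - y‖ ^ 2) /
      ∫ v, Real.exp (-(1 / (2 * β ^ 2)) * ‖obsMap φ F v - y‖ ^ 2) ∂μ)

/-- `F` is Lipschitz on every ball centered at the origin. -/
def IsLocallyLipschitz (F : EuclideanSpace ℝ (Fin N) → EuclideanSpace ℝ (Fin M)) : Prop :=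
  ∀ r : ℝ, 0 < r → ∃ L : ℝ, 0 < L ∧
    ∀ z₁ ∈ Metric.ball (0 : EuclideanSpace ℝ (Fin N)) r,
      ∀ z₂ ∈ Metric.ball (0 : EuclideanSpace ℝ (Fin N)) r, ‖F z₁ - F z₂‖ ≤ L * ‖z₁ - z₂‖

/-- `u` is a mode of `ν`: `ν (B_r(u)) / sup_v ν (B_r(v)) → 1` as the radius `r > 0` tends to `0`. -/
def IsMode [MeasurableSpace X] (ν : Measure X) (u : X) : Prop :=
  Tendsto (fun r : ℝ => ν (Metric.ball u r) / ⨆ v : X, ν (Metric.ball v r)) (𝓝[>] 0) (𝓝 1)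

open Classical in
/-- The Onsager-Machlup functional
`J(u) = |F (φ u) - y|² / (2 β²) + ‖u‖²_{H(μ)} / 2` on `H(μ)`, and `J(u) = ∞` outside `H(μ)`. -/
noncomputable def onsagerMachlup [CompleteSpace X] [MeasurableSpace X] [BorelSpace X]
    (μ : Measure X) (φ : Fin N → StrongDual ℝ X)
    (F : EuclideanSpace ℝ (Fin N) → EuclideanSpace ℝ (Fin M)) (y : EuclideanSpace ℝ (Fin M))
    (β : ℝ) (u : X) : ℝ≥0∞ :=
  if hu : u ∈ cameronMartin μ then
    ENNReal.ofReal (1 / (2 * β ^ 2) * ‖obsMap φ F u - y‖ ^ 2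
      + 1 / 2 * cameronMartinNorm μ ⟨u, hu⟩ ^ 2)
  else ⊤

end Posterior

end GaussianMAP

/-! Write `f = Ψ ∘ A` for the misfit, with `A` the bounded map into `ℝ^N` built from `φ`. The
posterior is a multiple of `exp (-f) μ`, and constants do not affect modes. Every small-ball mass is
compared with `μ (B_r(0))`, and the claim is that the ratio at `u` behaves like `exp (-J u)`.

Lower bound: the Cameron–Martin formula and the symmetry of `μ` give `exp_mul_measure_ball_zero_le`.
Upper bound: shifting by `K w` and applying Anderson's inequality bounds `μ (B_r(v))` by `exp
(‖K^(1/2) w‖² / 2 - ⟪w, v⟫ + r ‖w‖) μ (B_r(0))` for every `w` (`measure_ball_le_exp`). By duality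
(`exists_forall_inner_eq_of_quadratic_le`), the best `w` recovers `‖v‖²_{H(μ)} / 2`, or `∞` off
`H(μ)`. Hence a point that does not minimize `J` is not a mode.

For the converse the upper bound must be uniform in `v`. As `f` sees only `A v`, directions `w = A†
c` suffice: finitely many cover a compact box in `ℝ^N`, and `± A† eᵢ` handle its complement
(`eventually_forall_expWeighted_comp_ball_le`). No compactness in `X` is needed. -/

namespace GaussianMAP

/-! ### Anderson's inequality for independent real Gaussians -/

section Anderson

lemma gaussianPDFReal_zero_anti (v : NNReal) {x y : ℝ} (h : y ^ 2 ≤ x ^ 2) :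
    gaussianPDFReal 0 v x ≤ gaussianPDFReal 0 v y := by
  simp only [gaussianPDFReal_def, sub_zero]
  gcongr

/-- Among the intervals of a given length, the centered one has the largest centered Gaussian
measure. -/
lemma gaussianReal_setOf_sq_sub_lt_le_of_nonneg (v : NNReal) {a : ℝ} (ha : 0 ≤ a) (s : ℝ) :
    gaussianReal 0 v {x | (x - a) ^ 2 < s} ≤ gaussianReal 0 v {x | x ^ 2 < s} := by
  rcases le_or_gt s 0 with hs | hs
  · have : {x : ℝ | (x - a) ^ 2 < s} = ∅ := by
      ext x
      simpa using hs.trans (sq_nonneg _)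
    simp [this]
  rcases eq_or_ne v 0 with rfl | hv
  · simp only [gaussianReal_zero_var]
    have h0 : (0 : ℝ) ∈ {x : ℝ | x ^ 2 < s} := by simpa using hs
    rw [Measure.dirac_apply_of_mem h0]
    exact prob_le_one
  have hset : ∀ c : ℝ, {x : ℝ | (x - c) ^ 2 < s} = Set.Ioo (c - √s) (c + √s) := by
    intro c
    ext x
    rw [Set.mem_ofPred_eq, Real.sq_lt, Set.mem_Ioo]
    constructor <;> rintro ⟨h1, h2⟩ <;> constructor <;> linarith
  have h0 : {x : ℝ | x ^ 2 < s} = Set.Ioo (-√s) (√s) := by simpa using hset 0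
  have ht : 0 ≤ √s := Real.sqrt_nonneg s
  rw [hset, h0, gaussianReal_apply_eq_integral _ hv, gaussianReal_apply_eq_integral _ hv]
  refine ENNReal.ofReal_le_ofReal ?_
  rw [← integral_Ioc_eq_integral_Ioo, ← integral_Ioc_eq_integral_Ioo,
    ← intervalIntegral.integral_of_le (by linarith), ← intervalIntegral.integral_of_le (by linarith)]
  have hi : ∀ b c : ℝ, IntervalIntegrable (gaussianPDFReal 0 v) volume b c :=
    fun b c => (integrable_gaussianPDFReal 0 v).intervalIntegrable
  have hi' : ∀ b c d : ℝ, IntervalIntegrable (fun x => gaussianPDFReal 0 v (x + d)) volume b c :=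
    fun b c d => ((integrable_gaussianPDFReal 0 v).comp_add_right d).intervalIntegrable
  -- The overlap of the two intervals cancels. What remains compares the density at `x + √s` and at
  -- `x - √s` for `0 ≤ x ≤ a`, and the first point is farther from `0`.
  rw [← sub_nonpos, intervalIntegral.integral_interval_sub_interval_comm (hi _ _) (hi _ _) (hi _ _),
    intervalIntegral.integral_symm (-√s), intervalIntegral.integral_symm (√s) (a + √s)]
  have h1 := intervalIntegral.integral_comp_add_right (gaussianPDFReal 0 v) (a := 0) (b := a) (√s)
  have h2 := intervalIntegral.integral_comp_add_right (gaussianPDFReal 0 v) (a := 0) (b := a) (-√s)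
  rw [zero_add] at h1 h2
  rw [sub_eq_add_neg a, ← h1, ← h2]
  have := intervalIntegral.integral_mono_on (μ := volume) ha (hi' 0 a (√s)) (hi' 0 a (-√s))
    fun x hx => gaussianPDFReal_zero_anti v (by nlinarith [mul_nonneg hx.1 ht])
  linarith

lemma gaussianReal_setOf_sq_sub_lt_le (v : NNReal) (a s : ℝ) :
    gaussianReal 0 v {x | (x - a) ^ 2 < s} ≤ gaussianReal 0 v {x | x ^ 2 < s} := by
  rcases le_total 0 a with ha | ha
  · exact gaussianReal_setOf_sq_sub_lt_le_of_nonneg v ha s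
  · have h := gaussianReal_setOf_sq_sub_lt_le_of_nonneg v (neg_nonneg.2 ha) s
    have hm : MeasurableSet {x : ℝ | (x - a) ^ 2 < s} :=
      measurableSet_lt (by fun_prop) (by fun_prop)
    have h2 : gaussianReal 0 v {x | (x - a) ^ 2 < s}
        = gaussianReal 0 v {x | (x - -a) ^ 2 < s} := by
      have h3 : (gaussianReal 0 v).map (fun x => -x) = gaussianReal 0 v := by
        rw [gaussianReal_map_neg, neg_zero]
      conv_lhs => rw [← h3, Measure.map_apply measurable_neg hm]
      congr 1
      ext x
      simp only [Set.mem_preimage, Set.mem_ofPred_eq]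
      rw [show (-x - a) ^ 2 = (x - -a) ^ 2 by ring]
    rwa [h2]

variable {Ω : Type*} [MeasurableSpace Ω] {P : Measure Ω} [IsProbabilityMeasure P]

/-- Conditioning on `Y = y` reduces this to the one-dimensional case at level `s - y`. -/
lemma measure_sq_sub_add_lt_le {ξ Y : Ω → ℝ} (hξ : Measurable ξ) (hY : Measurable Y)
    (hind : IndepFun ξ Y P) {v : NNReal} (hlaw : P.map ξ = gaussianReal 0 v) (a s : ℝ) :
    P {ω | (ξ ω - a) ^ 2 + Y ω < s} ≤ P {ω | ξ ω ^ 2 + Y ω < s} := by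
  have key : ∀ c : ℝ, P {ω | (ξ ω - c) ^ 2 + Y ω < s}
      = ∫⁻ y, gaussianReal 0 v {x | (x - c) ^ 2 < s - y} ∂(P.map Y) := by
    intro c
    have hm : MeasurableSet {p : ℝ × ℝ | (p.2 - c) ^ 2 + p.1 < s} :=
      measurableSet_lt (by fun_prop) (by fun_prop)
    have : IsProbabilityMeasure (P.map Y) := Measure.isProbabilityMeasure_map hY.aemeasurable
    have h1 : P {ω | (ξ ω - c) ^ 2 + Y ω < s}
        = P.map (fun ω => (Y ω, ξ ω)) {p : ℝ × ℝ | (p.2 - c) ^ 2 + p.1 < s} := by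
      rw [Measure.map_apply (hY.prodMk hξ) hm]
      rfl
    rw [h1, (indepFun_iff_map_prod_eq_prod_map_map hY.aemeasurable hξ.aemeasurable).1 hind.symm,
      hlaw, Measure.prod_apply hm]
    simp only [Set.preimage_ofPred_eq, lt_sub_iff_add_lt]
  have h0 := key 0
  simp only [sub_zero] at h0
  rw [key a, h0]
  exact lintegral_mono fun y => gaussianReal_setOf_sq_sub_lt_le v a (s - y)

/-- The coordinates are recentred one at a time, `T` being the set already treated: the sum over the
other coordinates is independent of the one being moved. -/
lemma measure_sum_sq_sub_lt_le {ι : Type*} [Fintype ι] {ξ : ι → Ω → ℝ}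
    (hξ : ∀ i, Measurable (ξ i)) (hind : iIndepFun ξ P) {v : ι → NNReal}
    (hlaw : ∀ i, P.map (ξ i) = gaussianReal 0 (v i)) (a : ι → ℝ) (s : ℝ) :
    P {ω | ∑ i, (ξ i ω - a i) ^ 2 < s} ≤ P {ω | ∑ i, ξ i ω ^ 2 < s} := by
  classical
  have key : ∀ T : Finset ι, P {ω | ∑ i, (ξ i ω - a i) ^ 2 < s}
      ≤ P {ω | ∑ i, (ξ i ω - if i ∈ T then 0 else a i) ^ 2 < s} := by
    intro T
    induction T using Finset.induction_on with
    | empty => simp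
    | insert j T hj ih =>
      refine ih.trans ?_
      have hsum : ∀ (b : ι → ℝ) (ω : Ω), ∑ i, (ξ i ω - b i) ^ 2
          = (ξ j ω - b j) ^ 2 + ∑ i ∈ Finset.univ.erase j, (ξ i ω - b i) ^ 2 :=
        fun b ω => (Finset.add_sum_erase _ _ (Finset.mem_univ j)).symm
      simp only [hsum]
      have hcongr : ∀ ω, ∑ i ∈ Finset.univ.erase j, (ξ i ω - if i ∈ insert j T then 0 else a i) ^ 2
          = ∑ i ∈ Finset.univ.erase j, (ξ i ω - if i ∈ T then 0 else a i) ^ 2 := by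
        intro ω
        refine Finset.sum_congr rfl fun i hi => ?_
        simp [Finset.ne_of_mem_erase hi]
      simp only [hcongr, Finset.mem_insert_self, if_true, sub_zero, hj, if_false]
      have hY : Measurable fun ω =>
          ∑ i ∈ Finset.univ.erase j, (ξ i ω - if i ∈ T then 0 else a i) ^ 2 := by fun_prop
      refine measure_sq_sub_add_lt_le (hξ j) hY ?_ (hlaw j) _ _
      have h1 := (hind.indepFun_finset (Finset.univ.erase j) {j} (by simp) hξ).symm
      have m1 : Measurable fun f : (↥({j} : Finset ι) → ℝ) => f ⟨j, by simp⟩ :=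
        measurable_pi_apply _
      have m2 : Measurable fun f : (↥(Finset.univ.erase j) → ℝ) =>
          ∑ i, (f i - if i.1 ∈ T then 0 else a i.1) ^ 2 := by fun_prop
      have h2 := h1.comp m1 m2
      convert! h2 using 1
      ext ω
      simp only [Function.comp]
      exact (Finset.sum_coe_sort (Finset.univ.erase j)
        (fun i => (ξ i ω - if i ∈ T then 0 else a i) ^ 2)).symm
  simpa using key Finset.univ

end Anderson

/-! ### Exhausting a ball from inside -/

section Ball

/-- Allows a little radius to be given up before a limit is taken. -/
lemma measure_ball_le_of_forall_lt {X : Type*} [PseudoMetricSpace X] [MeasurableSpace X]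
    (ν : Measure X) {v : X} {r : ℝ} {M : ℝ≥0∞}
    (h : ∀ r' < r, ν (Metric.ball v r') ≤ M) : ν (Metric.ball v r) ≤ M := by
  have hU : Metric.ball v r = ⋃ n : ℕ, Metric.ball v (r - 1 / ((n : ℝ) + 1)) := by
    ext x
    simp only [Set.mem_iUnion, Metric.mem_ball]
    constructor
    · intro hx
      obtain ⟨n, hn⟩ := exists_nat_one_div_lt (sub_pos.2 hx)
      exact ⟨n, by linarith⟩
    · rintro ⟨n, hn⟩
      have : (0 : ℝ) < 1 / ((n : ℝ) + 1) := Nat.one_div_pos_of_nat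
      linarith
  rw [hU, Monotone.measure_iUnion]
  · exact iSup_le fun n => h _ (by have : (0 : ℝ) < 1 / ((n : ℝ) + 1) := Nat.one_div_pos_of_nat
                                   linarith)
  · intro m n hmn
    exact Metric.ball_subset_ball (sub_le_sub_left (Nat.one_div_le_one_div hmn) r)

end Ball

/-! ### The square root of the covariance -/

section CovSqrt

variable {X : Type*} [NormedAddCommGroup X] [InnerProductSpace ℝ X] [CompleteSpace X]
  [MeasurableSpace X] [BorelSpace X]

lemma covSqrt_isPositive (μ : Measure X) : (covSqrt μ).IsPositive :=
  posSqrt_isPositive _ _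

lemma covSqrt_covSqrt (μ : Measure X) (x : X) :
    covSqrt μ (covSqrt μ x) = covarianceOperator μ x :=
  DFunLike.congr_fun (posSqrt_mul_self (covarianceOperator μ) _) x

lemma inner_covSqrt_left (μ : Measure X) (x y : X) :
    ⟪covSqrt μ x, y⟫_ℝ = ⟪x, covSqrt μ y⟫_ℝ :=
  (covSqrt_isPositive μ).isSymmetric x y

lemma covarianceOperator_inner_self (μ : Measure X) (x : X) :
    ⟪covarianceOperator μ x, x⟫_ℝ = ‖covSqrt μ x‖ ^ 2 := by
  rw [← covSqrt_covSqrt, inner_covSqrt_left, real_inner_self_eq_norm_sq]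

end CovSqrt

/-! ### Anderson's inequality in Hilbert space -/

section Gaussian

variable {X : Type*} [NormedAddCommGroup X] [InnerProductSpace ℝ X] [CompleteSpace X]
  [SecondCountableTopology X] [MeasurableSpace X] [BorelSpace X] {μ : Measure X} [IsGaussian μ]

lemma integral_inner_eq_zero (hμ : ∫ x, x ∂μ = 0) (w : X) : ∫ x, ⟪w, x⟫_ℝ ∂μ = 0 := by
  have h := integral_inner (𝕜 := ℝ) (IsGaussian.integrable_id (μ := μ)) w
  simpa [hμ] using h

lemma memLp_two_inner (w : X) : MemLp (fun x => ⟪w, x⟫_ℝ) 2 μ :=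
  (IsGaussian.memLp_two_id (μ := μ)).const_inner w

lemma covariance_inner (hμ : ∫ x, x ∂μ = 0) (w w' : X) :
    cov[fun x => ⟪w, x⟫_ℝ, fun x => ⟪w', x⟫_ℝ; μ] = ⟪covarianceOperator μ w, w'⟫_ℝ := by
  rw [covariance_eq_sub (memLp_two_inner w) (memLp_two_inner w'), integral_inner_eq_zero hμ,
    zero_mul, sub_zero, covarianceOperator_inner IsGaussian.memLp_two_id]
  rfl

lemma map_inner_eq_gaussianReal (hμ : ∫ x, x ∂μ = 0) (w : X) :
    μ.map (fun x => ⟪w, x⟫_ℝ) = gaussianReal 0 (⟪covarianceOperator μ w, w⟫_ℝ).toNNReal := by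
  have h : HasGaussianLaw (fun x => ⟪w, x⟫_ℝ) μ :=
    (IsGaussian.hasGaussianLaw_id (μ := μ)).map (innerSL ℝ w)
  rw [h.map_eq_gaussianReal, integral_inner_eq_zero hμ, ← covariance_self (by fun_prop),
    covariance_inner hμ]

lemma measure_sum_inner_sub_sq_lt_le (hμ : ∫ x, x ∂μ = 0) {ι : Type*} [Fintype ι] (f : ι → X)
    (hf : ∀ i j, i ≠ j → ⟪covarianceOperator μ (f i), f j⟫_ℝ = 0) (a : ι → ℝ) (s : ℝ) :
    μ {x | ∑ i, (⟪f i, x⟫_ℝ - a i) ^ 2 < s} ≤ μ {x | ∑ i, ⟪f i, x⟫_ℝ ^ 2 < s} := by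
  refine measure_sum_sq_sub_lt_le (ξ := fun i x => ⟪f i, x⟫_ℝ) (fun i => by fun_prop) ?_
    (fun i => map_inner_eq_gaussianReal hμ (f i)) a s
  refine HasGaussianLaw.iIndepFun_of_covariance_eq_zero ?_ fun i j hij => ?_
  · exact (IsGaussian.hasGaussianLaw_id (μ := μ)).map
      (ContinuousLinearMap.pi fun i => innerSL ℝ (f i))
  · rw [covariance_inner hμ, hf i j hij]

/-- In an orthonormal eigenbasis of the compression of `K` to `V` the coordinates are uncorrelated,
hence independent by joint Gaussianity. -/
lemma measure_norm_starProjection_sub_lt_le (hμ : ∫ x, x ∂μ = 0) (V : Submodule ℝ X)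
    [FiniteDimensional ℝ V] (v : X) {r : ℝ} (hr : 0 < r) :
    μ {x | ‖V.starProjection (x - v)‖ < r} ≤ μ {x | ‖V.starProjection x‖ < r} := by
  let T : V →ₗ[ℝ] V :=
    (V.orthogonalProjectionOnto : X →ₗ[ℝ] V) ∘ₗ (covarianceOperator μ : X →ₗ[ℝ] X) ∘ₗ V.subtype
  have hTi : ∀ x y : V, ⟪T x, y⟫_ℝ = ⟪covarianceOperator μ (x : X), (y : X)⟫_ℝ := fun x y =>
    Submodule.inner_orthogonalProjectionOnto_eq_of_mem_right y _
  have hT : T.IsSymmetric := by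
    intro x y
    rw [hTi, real_inner_comm (T y), hTi, real_inner_comm (x : X)]
    exact (isPositive_covarianceOperator (μ := μ)).isSymmetric x y
  let b := hT.eigenvectorBasis rfl
  have hb : ∀ x, ‖V.starProjection x‖ ^ 2 = ∑ i, ⟪(b i : X), x⟫_ℝ ^ 2 := by
    intro x
    have h1 := b.sum_sq_norm_inner_right (V.orthogonalProjectionOnto x)
    have h2 : ∀ i, ⟪b i, V.orthogonalProjectionOnto x⟫_ℝ = ⟪(b i : X), x⟫_ℝ := fun i =>
      Submodule.inner_orthogonalProjectionOnto_eq_of_mem_left (b i) x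
    simp only [h2, Real.norm_eq_abs, sq_abs] at h1
    rw [h1]
    rfl
  have hlt : ∀ x, ‖V.starProjection x‖ < r ↔ ∑ i, ⟪(b i : X), x⟫_ℝ ^ 2 < r ^ 2 := by
    intro x
    rw [← hb, sq_lt_sq₀ (norm_nonneg _) hr.le]
  simp only [hlt, inner_sub_right]
  refine measure_sum_inner_sub_sq_lt_le hμ _ (fun i j hij => ?_) _ _
  rw [← hTi, hT.apply_eigenvectorBasis, inner_smul_left, b.orthonormal.2 hij, mul_zero]

/-- Anderson's inequality for balls: the centered ball has the largest measure. -/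
theorem measure_ball_le_measure_ball_zero (hμ : ∫ x, x ∂μ = 0) (v : X) (r : ℝ) :
    μ (Metric.ball v r) ≤ μ (Metric.ball 0 r) := by
  -- In the limit over projections, `‖P_n x‖ < r'` yields only `‖x‖ ≤ r'`, so `r' < r` is needed to
  -- land in the open ball.
  refine measure_ball_le_of_forall_lt μ fun r' hr' => ?_
  rcases le_or_gt r' 0 with h0 | h0
  · simp [Metric.ball_eq_empty.2 h0]
  let U : ℕ → Submodule ℝ X := fun n =>
    Submodule.span ℝ (Set.range fun i : Fin n => TopologicalSpace.denseSeq X i)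
  have hfd : ∀ n, FiniteDimensional ℝ (U n) := fun n =>
    FiniteDimensional.span_of_finite ℝ (Set.finite_range _)
  have hU : Monotone U := by
    intro m n hmn
    refine Submodule.span_mono ?_
    rintro _ ⟨i, rfl⟩
    exact ⟨⟨i, i.2.trans_le hmn⟩, rfl⟩
  have hdense : ⊤ ≤ (⨆ n, U n).topologicalClosure := by
    intro x _
    refine closure_mono ?_ (TopologicalSpace.denseRange_denseSeq X x)
    rintro _ ⟨n, rfl⟩
    exact Submodule.mem_iSup_of_mem (n + 1) (Submodule.subset_span ⟨⟨n, n.lt_succ_self⟩, rfl⟩)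
  have hlim : ∀ x, Tendsto (fun n => ‖(U n).starProjection x‖) atTop (𝓝 ‖x‖) := fun x =>
    (Submodule.starProjection_tendsto_self U hU x hdense).norm
  have hmono : ∀ x, Monotone fun n => ‖(U n).starProjection x‖ := by
    intro x m n hmn
    have h1 : (U m).starProjection x = (U m).starProjection ((U n).starProjection x) := by
      rw [← ContinuousLinearMap.comp_apply,
        Submodule.starProjection_comp_starProjection_of_le (hU hmn)]
    simp only
    rw [h1]
    exact Submodule.norm_starProjection_apply_le _ _
  have hle : ∀ n, μ (Metric.ball v r') ≤ μ {x | ‖(U n).starProjection x‖ < r'} := by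
    intro n
    refine (measure_mono fun x hx => ?_).trans (measure_norm_starProjection_sub_lt_le hμ (U n) v h0)
    rw [mem_ball_iff_norm] at hx
    exact (Submodule.norm_starProjection_apply_le _ _).trans_lt hx
  have hanti : Antitone fun n => {x | ‖(U n).starProjection x‖ < r'} :=
    fun m n hmn x hx => (hmono x hmn).trans_lt hx
  have htend := tendsto_measure_iInter_atTop (μ := μ)
    (fun n => (measurableSet_lt (by fun_prop) (by fun_prop)).nullMeasurableSet) hanti
    ⟨0, measure_ne_top _ _⟩
  refine (ge_of_tendsto' htend hle).trans (measure_mono fun x hx => ?_)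
  rw [mem_ball_zero_iff]
  refine lt_of_le_of_lt (le_of_tendsto' (hlim x) fun n => ?_) hr'
  exact (Set.mem_iInter.1 hx n).le

/-- If the centred ball were null, all balls of radius `r` would be null by Anderson, and `μ` would
vanish. -/
lemma measure_ball_zero_pos (hμ : ∫ x, x ∂μ = 0) {r : ℝ} (hr : 0 < r) :
    0 < μ (Metric.ball 0 r) := by
  by_contra! h
  have hall : ∀ v, μ (Metric.ball v r) = 0 := fun v =>
    le_antisymm ((measure_ball_le_measure_ball_zero hμ v r).trans h) zero_le
  have huniv : μ Set.univ = 0 :=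
    measure_null_of_locally_null _ fun x _ => ⟨Metric.ball x r, mem_nhdsWithin_of_mem_nhds
      (Metric.ball_mem_nhds x hr), hall x⟩
  simp at huniv

lemma map_neg_eq_self (hμ : ∫ x, x ∂μ = 0) : μ.map (fun x => -x) = μ := by
  have : IsProbabilityMeasure (μ.map fun x => -x) :=
    Measure.isProbabilityMeasure_map (by fun_prop)
  refine Measure.ext_of_charFun ?_
  ext t
  have h : HasGaussianLaw (fun x : X => -x) μ := (IsGaussian.hasGaussianLaw_id (μ := μ)).neg
  have h1 : ∀ ω : X, ⟪t, -ω⟫_ℝ = -⟪t, ω⟫_ℝ := fun ω => inner_neg_right _ _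
  rw [h.charFun_map_eq, IsGaussian.charFun_eq, integral_complex_ofReal]
  simp only [h1, integral_neg, integral_inner_eq_zero hμ t, neg_zero, variance_fun_neg]

end Gaussian

/-! ### The Cameron–Martin formula and bounds for shifted balls -/

section CameronMartinFormula

/-- For nonzero variance, the density of `N(s, s)` relative to `N(0, s)` is `exp (t - s / 2)`. -/
lemma lintegral_gaussianReal_add (s : NNReal) {g : ℝ → ℝ≥0∞} (hg : Measurable g) :
    ∫⁻ t, g (t + s) ∂gaussianReal 0 s
      = ∫⁻ t, g t * ENNReal.ofReal (Real.exp (t - s / 2)) ∂gaussianReal 0 s := by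
  rcases eq_or_ne s 0 with rfl | hs
  · simp
  rw [← lintegral_map (f := g) hg (measurable_add_const (s : ℝ)), gaussianReal_map_add_const,
    zero_add, gaussianReal_of_var_ne_zero _ hs, gaussianReal_of_var_ne_zero _ hs,
    lintegral_withDensity_eq_lintegral_mul _ (measurable_gaussianPDF _ _) hg,
    lintegral_withDensity_eq_lintegral_mul _ (measurable_gaussianPDF _ _) (by fun_prop)]
  refine lintegral_congr fun t => ?_
  have hs' : (s : ℝ) ≠ 0 := by exact_mod_cast hs
  have h : gaussianPDF s s t = gaussianPDF 0 s t * ENNReal.ofReal (Real.exp (t - s / 2)) := by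
    rw [gaussianPDF_def, gaussianPDF_def, ← ENNReal.ofReal_mul (gaussianPDFReal_nonneg _ _ _),
      gaussianPDFReal_def, gaussianPDFReal_def]
    simp only
    rw [mul_assoc _ (Real.exp _), ← Real.exp_add]
    congr 3
    field_simp
    ring
  simp only [Pi.mul_apply]
  rw [h]
  ring

variable {X : Type*} [NormedAddCommGroup X] [InnerProductSpace ℝ X] [CompleteSpace X]
  [SecondCountableTopology X] [MeasurableSpace X] [BorelSpace X] {μ : Measure X} [IsGaussian μ]

/-- The Cameron-Martin formula for shifts in the range of the covariance operator. -/
theorem lintegral_add_covarianceOperator (hμ : ∫ x, x ∂μ = 0) (w : X) {f : X → ℝ≥0∞}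
    (hf : Measurable f) :
    ∫⁻ x, f (x + covarianceOperator μ w) ∂μ
      = ∫⁻ x, f x * ENNReal.ofReal
          (Real.exp (⟪w, x⟫_ℝ - ⟪covarianceOperator μ w, w⟫_ℝ / 2)) ∂μ := by
  have hlaw := map_inner_eq_gaussianReal hμ w
  set s := ⟪covarianceOperator μ w, w⟫_ℝ with hs
  have hs0 : 0 ≤ s := by rw [hs, covarianceOperator_inner_self]; positivity
  rcases hs0.eq_or_lt with h0 | hpos
  · have hK : covarianceOperator μ w = 0 := by
      rw [covarianceOperator_inner_self] at hs
      have h1 : covSqrt μ w = 0 := norm_eq_zero.1 (pow_eq_zero_iff two_ne_zero |>.1 (hs ▸ h0.symm))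
      rw [← covSqrt_covSqrt, h1, map_zero]
    rw [← h0, Real.toNNReal_zero, gaussianReal_zero_var] at hlaw
    have hae : ∀ᵐ x ∂μ, ⟪w, x⟫_ℝ = 0 := by
      refine ae_of_ae_map (f := fun x => ⟪w, x⟫_ℝ) (p := fun t => t = 0) (by fun_prop) ?_
      rw [hlaw, ae_dirac_eq]
      rfl
    refine lintegral_congr_ae ?_
    filter_upwards [hae] with x hx
    simp [hK, hx, ← h0]
  -- With this `a`, the remainder `Z x = x - ⟪w, x⟫ a` is uncorrelated with `⟪w, x⟫`, hence
  -- independent of it. Since `K w = s a`, the shift only moves the scalar coordinate, by its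
  -- variance `s`.
  let a : X := (1 / s) • covarianceOperator μ w
  have ha : s • a = covarianceOperator μ w := by
    simp [a, smul_smul, mul_inv_cancel₀ hpos.ne']
  let Z : X → X := fun x => x - ⟪w, x⟫_ℝ • a
  have hZ : Measurable Z := by fun_prop
  have hind : IndepFun Z (fun x => ⟪w, x⟫_ℝ) μ := by
    refine HasGaussianLaw.indepFun_of_covariance_inner ?_ fun y c => ?_
    · exact (IsGaussian.hasGaussianLaw_id (μ := μ)).map
        ((ContinuousLinearMap.id ℝ X - (innerSL ℝ w).smulRight a).prod (innerSL ℝ w))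
    · have h1 : (fun x => ⟪y, Z x⟫_ℝ) = fun x => ⟪y - ⟪y, a⟫_ℝ • w, x⟫_ℝ := by
        ext x
        simp only [Z, inner_sub_right, inner_smul_right, inner_sub_left, inner_smul_left]
        simp [mul_comm]
      have h2 : (fun x => ⟪c, ⟪w, x⟫_ℝ⟫_ℝ) = fun x => ⟪c • w, x⟫_ℝ := by
        ext x
        simp [inner_smul_left, mul_comm]
      rw [h1, h2, covariance_comm, covariance_inner hμ, map_smul, inner_smul_left, inner_sub_right,
        inner_smul_right, ← hs, ← ha, inner_smul_left, real_inner_comm]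
      simp only [conj_trivial]
      ring
  have hprod : ∀ g : X × ℝ → ℝ≥0∞, Measurable g → ∫⁻ x, g (Z x, ⟪w, x⟫_ℝ) ∂μ
      = ∫⁻ z, ∫⁻ t, g (z, t) ∂gaussianReal 0 s.toNNReal ∂(μ.map Z) := by
    intro g hg
    have hm : Measurable fun x => (Z x, ⟪w, x⟫_ℝ) := by fun_prop
    rw [← lintegral_map (f := g) hg hm,
      (indepFun_iff_map_prod_eq_prod_map_map hZ.aemeasurable (by fun_prop)).1 hind, hlaw,
      lintegral_prod _ hg.aemeasurable]
  have hx : ∀ x, x = Z x + ⟪w, x⟫_ℝ • a := fun x => by simp [Z]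
  have h1 := hprod (fun p => f (p.1 + (p.2 + s) • a)) (by fun_prop)
  have h2 := hprod (fun p => f (p.1 + p.2 • a) * ENNReal.ofReal (Real.exp (p.2 - s / 2)))
    (by fun_prop)
  have e1 : ∀ x, Z x + (⟪w, x⟫_ℝ + s) • a = x + covarianceOperator μ w := fun x => by
    rw [add_smul, ha, ← add_assoc, ← hx]
  simp only [e1] at h1
  simp only [← hx] at h2
  rw [h1, h2]
  refine lintegral_congr fun z => ?_
  have h3 := lintegral_gaussianReal_add s.toNNReal (g := fun t => f (z + t • a)) (by fun_prop)
  rwa [Real.coe_toNNReal s hs0] at h3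

/-- The Cameron–Martin formula applied to the indicator of the ball times the reciprocal density. -/
lemma measure_ball_eq_setLIntegral (hμ : ∫ x, x ∂μ = 0) (v w : X) (r : ℝ) :
    μ (Metric.ball v r) = ∫⁻ x in Metric.ball (v - covarianceOperator μ w) r,
      ENNReal.ofReal (Real.exp (-⟪w, x⟫_ℝ - ‖covSqrt μ w‖ ^ 2 / 2)) ∂μ := by
  have hs := covarianceOperator_inner_self μ w
  have hm : Measurable ((Metric.ball v r).indicator fun x : X =>
      ENNReal.ofReal (Real.exp (-(⟪w, x⟫_ℝ - ‖covSqrt μ w‖ ^ 2 / 2)))) :=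
    Measurable.indicator (by fun_prop) measurableSet_ball
  have hcm := lintegral_add_covarianceOperator hμ w hm
  set h := covarianceOperator μ w with hh
  rw [hs] at hcm
  set s := ‖covSqrt μ w‖ ^ 2
  have h1 : ∀ x : X, (Metric.ball v r).indicator (fun x : X =>
      ENNReal.ofReal (Real.exp (-(⟪w, x⟫_ℝ - s / 2)))) x
        * ENNReal.ofReal (Real.exp (⟪w, x⟫_ℝ - s / 2)) = (Metric.ball v r).indicator 1 x := by
    intro x
    by_cases hx : x ∈ Metric.ball v r
    · rw [Set.indicator_of_mem hx, Set.indicator_of_mem hx,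
        ← ENNReal.ofReal_mul (Real.exp_nonneg _), ← Real.exp_add, neg_add_cancel]
      simp
    · simp [Set.indicator_of_notMem hx]
  simp only [h1] at hcm
  rw [lintegral_indicator_one measurableSet_ball] at hcm
  rw [← hcm, ← lintegral_indicator measurableSet_ball]
  refine lintegral_congr fun x => ?_
  have h2 : x + h - v = x - (v - h) := by abel
  simp only [Set.indicator, mem_ball_iff_norm, h2, inner_add_right, real_inner_comm h w, hs]
  congr 3
  ring

/-- On the shifted ball `⟪w, x⟫` differs from `⟪w, v - K w⟫` by at most `r ‖w‖`; Anderson then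
recentres the ball. The direction `w` stays free, to be optimized later. -/
lemma measure_ball_le_exp (hμ : ∫ x, x ∂μ = 0) (v w : X) (r : ℝ) :
    μ (Metric.ball v r) ≤ ENNReal.ofReal (Real.exp
      (‖covSqrt μ w‖ ^ 2 / 2 - ⟪w, v⟫_ℝ + r * ‖w‖)) * μ (Metric.ball 0 r) := by
  have hs := covarianceOperator_inner_self μ w
  rw [measure_ball_eq_setLIntegral hμ v w r]
  set h := covarianceOperator μ w
  calc _ ≤ ∫⁻ x in Metric.ball (v - h) r, ENNReal.ofReal (Real.exp
          (‖covSqrt μ w‖ ^ 2 / 2 - ⟪w, v⟫_ℝ + r * ‖w‖)) ∂μ := by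
        refine setLIntegral_mono measurable_const fun x hx => ?_
        refine ENNReal.ofReal_le_ofReal (Real.exp_le_exp.2 ?_)
        have h2 : ⟪w, v - h - x⟫_ℝ ≤ ‖w‖ * ‖v - h - x‖ := real_inner_le_norm _ _
        have h3 : ‖v - h - x‖ ≤ r := by rw [norm_sub_rev]; exact (mem_ball_iff_norm.1 hx).le
        have h4 := mul_le_mul_of_nonneg_left h3 (norm_nonneg w)
        rw [inner_sub_right, inner_sub_right, real_inner_comm h w, hs] at h2
        linarith
    _ = ENNReal.ofReal (Real.exp (‖covSqrt μ w‖ ^ 2 / 2 - ⟪w, v⟫_ℝ + r * ‖w‖))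
          * μ (Metric.ball (v - h) r) := by rw [setLIntegral_const]
    _ ≤ _ := mul_le_mul_right (measure_ball_le_measure_ball_zero hμ _ _) _

/-- Averaging the integral over `x` and `-x` replaces `exp (-⟪w, x⟫)` by `cosh ⟪w, x⟫ ≥ 1`. -/
lemma exp_mul_measure_ball_zero_le_of_covarianceOperator (hμ : ∫ x, x ∂μ = 0) (w : X) (r : ℝ) :
    ENNReal.ofReal (Real.exp (-(‖covSqrt μ w‖ ^ 2 / 2))) * μ (Metric.ball 0 r)
      ≤ μ (Metric.ball (covarianceOperator μ w) r) := by
  rw [measure_ball_eq_setLIntegral hμ (covarianceOperator μ w) w r, sub_self]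
  set s := ‖covSqrt μ w‖ ^ 2
  have hsymm : ∫⁻ x in Metric.ball 0 r, ENNReal.ofReal (Real.exp (-⟪w, x⟫_ℝ - s / 2)) ∂μ
      = ∫⁻ x in Metric.ball 0 r, ENNReal.ofReal (Real.exp (⟪w, x⟫_ℝ - s / 2)) ∂μ := by
    conv_lhs => rw [← map_neg_eq_self hμ]
    rw [setLIntegral_map measurableSet_ball (by fun_prop) measurable_neg]
    simp
  rw [← ENNReal.mul_le_mul_iff_right two_ne_zero ENNReal.ofNat_ne_top, two_mul (∫⁻ _ in _, _ ∂μ)]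
  nth_rw 1 [hsymm]
  rw [← lintegral_add_left (by fun_prop), ← setLIntegral_const, ← lintegral_const_mul' _ _ (by simp)]
  refine lintegral_mono fun x => ?_
  simp only
  rw [← ENNReal.ofReal_add (Real.exp_nonneg _) (Real.exp_nonneg _), two_mul,
    ← ENNReal.ofReal_add (Real.exp_nonneg _) (Real.exp_nonneg _)]
  refine ENNReal.ofReal_le_ofReal ?_
  have e1 : ∀ t : ℝ, Real.exp (t - s / 2) = Real.exp t * Real.exp (-(s / 2)) := fun t => by
    rw [← Real.exp_add, sub_eq_add_neg]
  rw [e1, e1]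
  have h1 := Real.add_one_le_exp ⟪w, x⟫_ℝ
  have h2 := Real.add_one_le_exp (-⟪w, x⟫_ℝ)
  nlinarith [Real.exp_pos (-(s / 2))]

/-- Extends the previous bound from `K X` to `K^(1/2) X` by density: `K^(-1/2) u` lies in `(ker
K^(1/2))ᗮ`, the closure of the range of `K^(1/2)`, so `u` is a limit of points `K w_n` with
`‖K^(1/2) w_n‖ → ‖u‖_{H(μ)}`. -/
lemma exp_mul_measure_ball_zero_le (hμ : ∫ x, x ∂μ = 0) (u : cameronMartin μ) (r : ℝ) :
    ENNReal.ofReal (Real.exp (-(cameronMartinNorm μ u ^ 2 / 2))) * μ (Metric.ball 0 r)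
      ≤ μ (Metric.ball (u : X) r) := by
  have hmem : covInvSqrt μ u ∈ closure (Set.range (covSqrt μ)) := by
    have h1 := covInvSqrt_mem μ u
    have h2 := ContinuousLinearMap.orthogonal_ker (covSqrt μ)
    rw [(covSqrt_isPositive μ).isSelfAdjoint.adjoint_eq] at h2
    rw [h2] at h1
    exact h1
  obtain ⟨y, hy, hlim⟩ := mem_closure_iff_seq_limit.1 hmem
  choose w hw using hy
  have hlim1 : Tendsto (fun n => covSqrt μ (w n)) atTop (𝓝 (covInvSqrt μ u)) := by
    simpa only [hw] using hlim
  have hlim2 : Tendsto (fun n => covarianceOperator μ (w n)) atTop (𝓝 (u : X)) := by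
    have := ((covSqrt μ).continuous.tendsto _).comp hlim1
    rw [covSqrt_covInvSqrt] at this
    refine this.congr fun n => covSqrt_covSqrt μ (w n)
  set c := ENNReal.ofReal (Real.exp (-(cameronMartinNorm μ u ^ 2 / 2))) with hc
  have hcont : Tendsto (fun n => ENNReal.ofReal (Real.exp (-(‖covSqrt μ (w n)‖ ^ 2 / 2)))) atTop
      (𝓝 c) :=
    (ENNReal.continuous_ofReal.tendsto _).comp
      ((Real.continuous_exp.tendsto _).comp ((hlim1.norm.pow 2).div_const 2).neg)
  -- The gap `r - r'` absorbs the distance from `K w_n` to `u`.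
  refine measure_ball_le_of_forall_lt (c • μ) fun r' hr' => ?_
  have h1 := ENNReal.Tendsto.mul_const (b := μ (Metric.ball 0 r')) hcont
    (Or.inr (measure_ne_top _ _))
  refine le_of_tendsto h1 ?_
  filter_upwards [Metric.tendsto_nhds.1 hlim2 (r - r') (sub_pos.2 hr')] with n hn
  refine (exp_mul_measure_ball_zero_le_of_covarianceOperator hμ (w n) r').trans
    (measure_mono (Metric.ball_subset_ball' ?_))
  linarith

end CameronMartinFormula

/-! ### Quadratic duality -/

section Duality

variable {E X : Type*} [NormedAddCommGroup E] [InnerProductSpace ℝ E]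
  [NormedAddCommGroup X] [InnerProductSpace ℝ X] [CompleteSpace X]

/-- If the quadratic functional `c ↦ ⟪c, z⟫ - ‖T c‖² / 2` is bounded above by `b`, then
`z = T† x` for some `x` with `‖x‖² / 2 ≤ b`. -/
lemma exists_forall_inner_eq_of_quadratic_le (T : E →L[ℝ] X) (z : E) (b : ℝ)
    (h : ∀ c, ⟪c, z⟫_ℝ - ‖T c‖ ^ 2 / 2 ≤ b) :
    ∃ x : X, (∀ c, ⟪T c, x⟫_ℝ = ⟪c, z⟫_ℝ) ∧ ‖x‖ ^ 2 / 2 ≤ b := by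
  have hb : 0 ≤ b := by simpa using h 0
  -- Replacing `c` by `t c` gives a quadratic in `t` of constant sign, so its discriminant is
  -- nonpositive.
  have hbound : ∀ c, |⟪c, z⟫_ℝ| ≤ √(2 * b) * ‖T c‖ := by
    intro c
    have h1 : discrim (‖T c‖ ^ 2 / 2) (-⟪c, z⟫_ℝ) b ≤ 0 := by
      refine discrim_le_zero fun t => ?_
      have := h (t • c)
      rw [map_smul, norm_smul, inner_smul_left, mul_pow, Real.norm_eq_abs, sq_abs,
        conj_trivial] at this
      linarith
    rw [discrim] at h1
    rw [← Real.sqrt_sq (norm_nonneg (T c)), ← Real.sqrt_mul (by positivity)]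
    exact Real.abs_le_sqrt (by linarith)
  let T' : E →ₗ[ℝ] X := T
  let f : E →ₗ[ℝ] ℝ := (innerSL ℝ z : E →L[ℝ] ℝ)
  have hker : LinearMap.ker T' ≤ LinearMap.ker f := by
    intro c hc
    have h1 := hbound c
    have h2 : T c = 0 := hc
    rw [h2, norm_zero, mul_zero] at h1
    have h3 := abs_nonpos_iff.1 h1
    rw [real_inner_comm] at h3
    exact h3
  -- `⟪·, z⟫` factors through `T` as a functional on its range of norm at most `√(2b)`; Hahn–Banach
  -- and Riesz turn it into `x`.
  let g : LinearMap.range T' →ₗ[ℝ] ℝ :=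
    (LinearMap.ker T').liftQ f hker ∘ₗ T'.quotKerEquivRange.symm.toLinearMap
  have hg : ∀ c, g ⟨T c, LinearMap.mem_range_self T' c⟩ = ⟪c, z⟫_ℝ := by
    intro c
    have h1 := T'.quotKerEquivRange_symm_apply_image c (LinearMap.mem_range_self T' c)
    change (LinearMap.ker T').liftQ f hker (T'.quotKerEquivRange.symm ⟨T' c, _⟩) = _
    rw [h1, Submodule.mkQ_apply, Submodule.liftQ_apply, real_inner_comm]
    rfl
  let g' : StrongDual ℝ (LinearMap.range T') := g.mkContinuous √(2 * b) (by
    rintro ⟨_, c, rfl⟩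
    have := hbound c
    rw [← hg c] at this
    exact this)
  obtain ⟨k, hk, hkn⟩ := exists_extension_norm_eq (LinearMap.range T') g'
  refine ⟨(InnerProductSpace.toDual ℝ X).symm k, fun c => ?_, ?_⟩
  · rw [real_inner_comm, InnerProductSpace.toDual_symm_apply, ← hg c]
    exact hk ⟨T c, LinearMap.mem_range_self T' c⟩
  · rw [LinearIsometryEquiv.norm_map, hkn]
    have h1 : ‖g'‖ ≤ √(2 * b) := LinearMap.mkContinuous_norm_le _ (Real.sqrt_nonneg _) _
    have h2 : ‖g'‖ ^ 2 ≤ 2 * b := by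
      rw [← Real.sq_sqrt (show 0 ≤ 2 * b by positivity)]
      gcongr
    linarith

end Duality

/-! ### Minimality of the Cameron–Martin norm -/

section CameronMartinNorm

variable {X : Type*} [NormedAddCommGroup X] [InnerProductSpace ℝ X] [CompleteSpace X]
  [MeasurableSpace X] [BorelSpace X]

/-- `K^(-1/2) u` is the orthogonal projection of any preimage `x` onto `(ker K^(1/2))ᗮ`. -/
lemma cameronMartinNorm_le (μ : Measure X) (u : cameronMartin μ) {x : X}
    (hx : covSqrt μ x = u) : cameronMartinNorm μ u ≤ ‖x‖ := by
  have : CompleteSpace (LinearMap.ker (covSqrt μ : X →ₗ[ℝ] X)) :=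
    (covSqrt μ).isClosed_ker.completeSpace_coe
  have h1 : covInvSqrt μ u = (LinearMap.ker (covSqrt μ : X →ₗ[ℝ] X))ᗮ.starProjection x := by
    refine (covInvSqrt_unique μ u _ (Submodule.starProjection_apply_mem _ _) ?_).symm
    have h2 := Submodule.sub_starProjection_mem_orthogonal
      (K := (LinearMap.ker (covSqrt μ : X →ₗ[ℝ] X))ᗮ) x
    rw [Submodule.orthogonal_orthogonal] at h2
    have h3 : covSqrt μ (x - (LinearMap.ker (covSqrt μ : X →ₗ[ℝ] X))ᗮ.starProjection x) = 0 := h2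
    rw [map_sub, sub_eq_zero, hx] at h3
    exact h3.symm
  rw [cameronMartinNorm, h1]
  exact Submodule.norm_starProjection_apply_le _ _

end CameronMartinNorm

/-! ### Small-ball asymptotics of the weighted measure -/

section SmallBalls

variable {X : Type*} [NormedAddCommGroup X] [InnerProductSpace ℝ X] [CompleteSpace X]
  [SecondCountableTopology X] [MeasurableSpace X] [BorelSpace X] {μ : Measure X} [IsGaussian μ]

/-- The measure with density `exp (-f)` with respect to `μ`. -/
noncomputable def expWeighted (μ : Measure X) (f : X → ℝ) : Measure X :=
  μ.withDensity fun x => ENNReal.ofReal (Real.exp (-f x))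

/-- Upper bound for the weighted measure of small balls, uniform in the center. -/
lemma eventually_forall_expWeighted_ball_le (hμ : ∫ x, x ∂μ = 0) (f : X → ℝ) (s : Set X) (w : X)
    {p q a δ : ℝ} (hδ : 0 < δ) (hp : ∀ v ∈ s, ∀ x ∈ Metric.ball v δ, p ≤ f x)
    (hq : ∀ v ∈ s, q ≤ ⟪w, v⟫_ℝ) (ha : a < p + q - ‖covSqrt μ w‖ ^ 2 / 2) :
    ∀ᶠ r in 𝓝[>] (0 : ℝ), ∀ v ∈ s, expWeighted μ f (Metric.ball v r)
      ≤ ENNReal.ofReal (Real.exp (-a)) * μ (Metric.ball 0 r) := by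
  have h1 : ∀ᶠ r in 𝓝[>] (0 : ℝ), r < δ :=
    nhdsWithin_le_nhds (gt_mem_nhds hδ)
  have h2 : ∀ᶠ r in 𝓝[>] (0 : ℝ), r * ‖w‖ < p + q - ‖covSqrt μ w‖ ^ 2 / 2 - a := by
    have h3 : Tendsto (fun r : ℝ => r * ‖w‖) (𝓝 0) (𝓝 (0 * ‖w‖)) :=
      (continuous_id.mul continuous_const).tendsto _
    rw [zero_mul] at h3
    exact nhdsWithin_le_nhds (h3.eventually_lt_const (sub_pos.2 ha))
  filter_upwards [h1, h2] with r hr1 hr2 v hv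
  calc expWeighted μ f (Metric.ball v r)
      ≤ ENNReal.ofReal (Real.exp (-p)) * μ (Metric.ball v r) := by
        rw [expWeighted, withDensity_apply _ measurableSet_ball, ← setLIntegral_const]
        refine setLIntegral_mono measurable_const fun x hx => ?_
        have := hp v hv x (Metric.ball_subset_ball hr1.le hx)
        gcongr
    _ ≤ ENNReal.ofReal (Real.exp (-p)) * (ENNReal.ofReal (Real.exp
          (‖covSqrt μ w‖ ^ 2 / 2 - ⟪w, v⟫_ℝ + r * ‖w‖)) * μ (Metric.ball 0 r)) := by
        gcongr
        exact measure_ball_le_exp hμ v w r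
    _ ≤ _ := by
        rw [← mul_assoc, ← ENNReal.ofReal_mul (Real.exp_nonneg _), ← Real.exp_add]
        have := hq v hv
        gcongr
        linarith

/-- Off `H(μ)` the hypothesis is vacuous, so every real `a` is allowed and the mass is negligible
against `μ (B_r(0))`. -/
lemma eventually_expWeighted_ball_le (hμ : ∫ x, x ∂μ = 0) {f : X → ℝ} (hf : Continuous f) (u : X)
    {a : ℝ} (ha : ∀ hu : u ∈ cameronMartin μ, a < f u + cameronMartinNorm μ ⟨u, hu⟩ ^ 2 / 2) :
    ∀ᶠ r in 𝓝[>] (0 : ℝ), expWeighted μ f (Metric.ball u r)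
      ≤ ENNReal.ofReal (Real.exp (-a)) * μ (Metric.ball 0 r) := by
  -- Otherwise duality gives `u = K^(1/2) x` with `‖x‖² / 2 ≤ a - f u`, contradicting `ha`.
  obtain ⟨w, hw⟩ : ∃ w, a - f u < ⟪w, u⟫_ℝ - ‖covSqrt μ w‖ ^ 2 / 2 := by
    by_contra! h
    obtain ⟨x, hx, hxn⟩ := exists_forall_inner_eq_of_quadratic_le (covSqrt μ) u _ h
    have hxu : covSqrt μ x = u := ext_inner_left ℝ fun c => by rw [← hx, inner_covSqrt_left]
    have hu : u ∈ cameronMartin μ := ⟨x, hxu⟩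
    have h1 := cameronMartinNorm_le μ ⟨u, hu⟩ hxu
    have h2 : 0 ≤ cameronMartinNorm μ ⟨u, hu⟩ := norm_nonneg _
    nlinarith [ha hu]
  obtain ⟨p, hp1, hp2⟩ : ∃ p, a - ⟪w, u⟫_ℝ + ‖covSqrt μ w‖ ^ 2 / 2 < p ∧ p < f u :=
    exists_between (by linarith)
  obtain ⟨δ, hδ, hball⟩ := Metric.mem_nhds_iff.1 (hf.continuousAt.eventually_const_lt hp2)
  have := eventually_forall_expWeighted_ball_le hμ f {u} w (p := p) (q := ⟪w, u⟫_ℝ) (a := a) hδ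
    (by rintro _ rfl x hx; exact (hball hx).le) (by rintro _ rfl; rfl) (by linarith)
  simpa using this

lemma eventually_le_expWeighted_ball (hμ : ∫ x, x ∂μ = 0) {f : X → ℝ} (hf : Continuous f)
    (u : cameronMartin μ) {a : ℝ} (ha : f u + cameronMartinNorm μ u ^ 2 / 2 < a) :
    ∀ᶠ r in 𝓝[>] (0 : ℝ), ENNReal.ofReal (Real.exp (-a)) * μ (Metric.ball 0 r)
      ≤ expWeighted μ f (Metric.ball (u : X) r) := by
  obtain ⟨δ, hδ, hball⟩ := Metric.mem_nhds_iff.1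
    (hf.continuousAt.eventually_lt_const (lt_sub_iff_add_lt.2 ha))
  filter_upwards [nhdsWithin_le_nhds (gt_mem_nhds hδ)] with r hr
  calc _ = ENNReal.ofReal (Real.exp (-(a - cameronMartinNorm μ u ^ 2 / 2)))
          * (ENNReal.ofReal (Real.exp (-(cameronMartinNorm μ u ^ 2 / 2)))
            * μ (Metric.ball 0 r)) := by
        rw [← mul_assoc, ← ENNReal.ofReal_mul (Real.exp_nonneg _), ← Real.exp_add]
        congr 3
        ring
    _ ≤ ENNReal.ofReal (Real.exp (-(a - cameronMartinNorm μ u ^ 2 / 2)))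
          * μ (Metric.ball (u : X) r) := by
        gcongr
        exact exp_mul_measure_ball_zero_le hμ u r
    _ ≤ _ := by
        rw [expWeighted, withDensity_apply _ measurableSet_ball, ← setLIntegral_const]
        refine setLIntegral_mono (by fun_prop) fun x hx => ?_
        have : f x < a - cameronMartinNorm μ u ^ 2 / 2 :=
          hball (Metric.ball_subset_ball hr.le hx)
        gcongr

variable {ι : Type*} [Fintype ι]

/-- The range of admissible `r` must not depend on `v`. With `w = A† c` the bound depends on `v`
only through `A v`, so compactness in the finite-dimensional target suffices. -/
lemma eventually_forall_expWeighted_comp_ball_le (hμ : ∫ x, x ∂μ = 0)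
    (A : X →L[ℝ] EuclideanSpace ℝ ι) {Ψ : EuclideanSpace ℝ ι → ℝ} (hΨ : Continuous Ψ)
    (hΨ0 : ∀ z, 0 ≤ Ψ z) {a : ℝ}
    (ha : ∀ u : cameronMartin μ, a < Ψ (A u) + cameronMartinNorm μ u ^ 2 / 2) :
    ∀ᶠ r in 𝓝[>] (0 : ℝ), ∀ v, expWeighted μ (fun x => Ψ (A x)) (Metric.ball v r)
      ≤ ENNReal.ofReal (Real.exp (-a)) * μ (Metric.ball 0 r) := by
  classical
  set B := ContinuousLinearMap.adjoint A with hB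
  have hBA : ∀ c v, ⟪B c, v⟫_ℝ = ⟪c, A v⟫_ℝ := fun c v =>
    ContinuousLinearMap.adjoint_inner_left A v c
  have hloc : ∀ z₀, ∃ t ∈ 𝓝 z₀, ∀ᶠ r in 𝓝[>] (0 : ℝ), ∀ v, A v ∈ t →
      expWeighted μ (fun x => Ψ (A x)) (Metric.ball v r)
        ≤ ENNReal.ofReal (Real.exp (-a)) * μ (Metric.ball 0 r) := by
    intro z₀
    -- Duality for `K^(1/2) A†`: otherwise `z₀ = A u` for some `u = K^(1/2) x` whose functional
    -- value is at most `a`.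
    obtain ⟨c, hc⟩ : ∃ c, a - Ψ z₀ < ⟪c, z₀⟫_ℝ - ‖(covSqrt μ ∘L B) c‖ ^ 2 / 2 := by
      by_contra! h
      obtain ⟨x, hx, hxn⟩ := exists_forall_inner_eq_of_quadratic_le (covSqrt μ ∘L B) z₀ _ h
      have hxz : A (covSqrt μ x) = z₀ := ext_inner_left ℝ fun c => by
        rw [← hx, ← hBA, ContinuousLinearMap.comp_apply, inner_covSqrt_left]
      let u : cameronMartin μ := ⟨covSqrt μ x, x, rfl⟩
      have h1 := cameronMartinNorm_le μ u (x := x) rfl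
      have h2 : 0 ≤ cameronMartinNorm μ u := norm_nonneg _
      have h3 := ha u
      rw [show A u = z₀ from hxz] at h3
      nlinarith
    rw [ContinuousLinearMap.comp_apply] at hc
    -- One `ε` pays for the variation of `Ψ` near `z₀`, the other for that of `⟪c, ·⟫`.
    obtain ⟨ε, hε, hε2⟩ : ∃ ε, 0 < ε ∧
        ε + ε < ⟪c, z₀⟫_ℝ - ‖covSqrt μ (B c)‖ ^ 2 / 2 - (a - Ψ z₀) := by
      refine ⟨(⟪c, z₀⟫_ℝ - ‖covSqrt μ (B c)‖ ^ 2 / 2 - (a - Ψ z₀)) / 3, ?_, ?_⟩ <;> linarith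
    have hn1 : ∀ᶠ z in 𝓝 z₀, Ψ z₀ - ε < Ψ z :=
      hΨ.continuousAt.eventually_const_lt (by linarith)
    have hn2 : ∀ᶠ z in 𝓝 z₀, ⟪c, z₀⟫_ℝ - ε < ⟪c, z⟫_ℝ :=
      (show Continuous fun z => ⟪c, z⟫_ℝ by fun_prop).continuousAt.eventually_const_lt
        (by linarith)
    obtain ⟨δ, hδ, hball⟩ := Metric.mem_nhds_iff.1 (hn1.and hn2)
    refine ⟨Metric.ball z₀ (δ / 2), Metric.ball_mem_nhds _ (by positivity), ?_⟩
    refine eventually_forall_expWeighted_ball_le hμ (fun x => Ψ (A x))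
      {v | A v ∈ Metric.ball z₀ (δ / 2)} (B c) (p := Ψ z₀ - ε) (q := ⟪c, z₀⟫_ℝ - ε)
      (δ := δ / 2 / (‖A‖ + 1)) (by positivity) (fun v hv x hx => ?_) (fun v hv => ?_) (by linarith)
    · have h1 : dist (A x) (A v) ≤ δ / 2 := by
        rw [dist_eq_norm, ← map_sub]
        refine (A.le_opNorm _).trans ?_
        rw [mem_ball_iff_norm, lt_div_iff₀ (by positivity)] at hx
        nlinarith [norm_nonneg (x - v)]
      have h2 : A x ∈ Metric.ball z₀ δ := by
        have h3 : dist (A v) z₀ < δ / 2 := hv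
        have := dist_triangle (A x) (A v) z₀
        rw [Metric.mem_ball]
        linarith
      exact (hball h2).1.le
    · rw [hBA]
      exact (hball (Metric.ball_subset_ball (by linarith) hv)).2.le
  -- Past this threshold the direction `± A† eᵢ` alone gives exponent `a + 1`, using only `Ψ ≥ 0`.
  let R : ι → ℝ := fun i => a + ‖covSqrt μ (B (EuclideanSpace.single i 1))‖ ^ 2 / 2 + 1
  have hout : ∀ i, ∀ σ : ℝ, |σ| = 1 → ∀ᶠ r in 𝓝[>] (0 : ℝ), ∀ v, R i ≤ σ * A v i →
      expWeighted μ (fun x => Ψ (A x)) (Metric.ball v r)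
        ≤ ENNReal.ofReal (Real.exp (-a)) * μ (Metric.ball 0 r) := by
    intro i σ hσ
    refine eventually_forall_expWeighted_ball_le hμ (fun x => Ψ (A x)) {v | R i ≤ σ * A v i}
      (B (σ • EuclideanSpace.single i 1)) (p := 0) (q := R i) one_pos (fun v _ x _ => hΨ0 _)
      (fun v hv => ?_) ?_
    · rw [hBA, inner_smul_left, EuclideanSpace.inner_single_left]
      simpa using hv
    · rw [map_smul, map_smul, norm_smul, Real.norm_eq_abs, hσ, one_mul]
      simp only [R]
      linarith
  have hcomp : IsCompact {z : EuclideanSpace ℝ ι | ∀ i, |z i| ≤ R i} := by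
    have h1 := (EuclideanSpace.equiv ι ℝ).toHomeomorph.isCompact_preimage.2
      (isCompact_Icc (a := -R) (b := R))
    convert! h1 using 1
    ext z
    simp only [Set.mem_ofPred_eq, Set.mem_preimage, Set.mem_Icc, Pi.le_def, abs_le, forall_and]
    rfl
  have hin : ∀ᶠ r in 𝓝[>] (0 : ℝ), ∀ v, A v ∈ {z : EuclideanSpace ℝ ι | ∀ i, |z i| ≤ R i} →
      expWeighted μ (fun x => Ψ (A x)) (Metric.ball v r)
        ≤ ENNReal.ofReal (Real.exp (-a)) * μ (Metric.ball 0 r) := by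
    refine hcomp.induction_on (p := fun t => ∀ᶠ r in 𝓝[>] (0 : ℝ), ∀ v, A v ∈ t →
      expWeighted μ (fun x => Ψ (A x)) (Metric.ball v r)
        ≤ ENNReal.ofReal (Real.exp (-a)) * μ (Metric.ball 0 r)) ?_ ?_ ?_ ?_
    · simp
    · intro s t hst ht
      filter_upwards [ht] with r hr v hv using hr v (hst hv)
    · intro s t hs ht
      filter_upwards [hs, ht] with r hr1 hr2 v hv
      exact hv.elim (hr1 v) (hr2 v)
    · intro z _
      obtain ⟨t, ht, h⟩ := hloc z
      exact ⟨t, mem_nhdsWithin_of_mem_nhds ht, h⟩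
  filter_upwards [hin, eventually_all.2 fun i => hout i 1 (by simp),
    eventually_all.2 fun i => hout i (-1) (by simp)] with r h1 h2 h3 v
  by_cases hv : ∀ i, |A v i| ≤ R i
  · exact h1 v hv
  · push Not at hv
    obtain ⟨i, hi⟩ := hv
    rcases lt_abs.1 hi with hi | hi
    · exact h2 i v (by linarith)
    · exact h3 i v (by linarith)

end SmallBalls

/-! ### Minimizers and modes -/

section Mode

lemma ofReal_exp_mul_div {b : ℝ≥0∞} (hb : b ≠ 0) (hb' : b ≠ ∞) (s t : ℝ) :
    ENNReal.ofReal (Real.exp s) * b / (ENNReal.ofReal (Real.exp t) * b)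
      = ENNReal.ofReal (Real.exp (s - t)) := by
  rw [ENNReal.mul_div_mul_right _ _ hb hb', ← ENNReal.ofReal_div_of_pos (Real.exp_pos _),
    Real.exp_sub]

lemma isMode_smul_iff {X : Type*} [NormedAddCommGroup X] [InnerProductSpace ℝ X]
    [MeasurableSpace X] (ν : Measure X) {c : ℝ≥0∞} (hc : c ≠ 0) (hc' : c ≠ ∞) (u : X) :
    IsMode (c • ν) u ↔ IsMode ν u := by
  simp only [IsMode, Measure.smul_apply, smul_eq_mul, ← ENNReal.mul_iSup,
    ENNReal.mul_div_mul_left _ _ hc hc']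

variable {X : Type*} [NormedAddCommGroup X] [InnerProductSpace ℝ X] [CompleteSpace X]
  [SecondCountableTopology X] [MeasurableSpace X] [BorelSpace X] {μ : Measure X} [IsGaussian μ]
  {ι : Type*} [Fintype ι]

/-- The uniform upper bound at level `m - ε` and the lower bound at `u` at level `m + ε` make the
ratio eventually at least `exp (-2ε)`; it never exceeds `1`. -/
lemma isMode_expWeighted_of_forall_le (hμ : ∫ x, x ∂μ = 0)
    (A : X →L[ℝ] EuclideanSpace ℝ ι) {Ψ : EuclideanSpace ℝ ι → ℝ} (hΨ : Continuous Ψ)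
    (hΨ0 : ∀ z, 0 ≤ Ψ z) (u : cameronMartin μ)
    (hu : ∀ v : cameronMartin μ, Ψ (A u) + cameronMartinNorm μ u ^ 2 / 2
      ≤ Ψ (A v) + cameronMartinNorm μ v ^ 2 / 2) :
    IsMode (expWeighted μ fun x => Ψ (A x)) (u : X) := by
  set m := Ψ (A u) + cameronMartinNorm μ u ^ 2 / 2
  refine tendsto_order.2 ⟨fun l hl => ?_, fun l hl => Eventually.of_forall fun r => ?_⟩
  · have hcont : Tendsto (fun ε : ℝ => ENNReal.ofReal (Real.exp (-(m + ε) - -(m - ε))))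
        (𝓝[>] 0) (𝓝 1) := by
      have h1 : Continuous fun ε : ℝ => ENNReal.ofReal (Real.exp (-(m + ε) - -(m - ε))) :=
        ENNReal.continuous_ofReal.comp (by fun_prop)
      have h2 := h1.tendsto 0
      simp only [add_zero, sub_zero, sub_self, Real.exp_zero, ENNReal.ofReal_one] at h2
      exact h2.mono_left nhdsWithin_le_nhds
    obtain ⟨ε, hlε, hε⟩ := ((hcont.eventually_const_lt hl).and self_mem_nhdsWithin).exists
    have hε' : (0 : ℝ) < ε := hε
    filter_upwards [self_mem_nhdsWithin,
      eventually_forall_expWeighted_comp_ball_le hμ A hΨ hΨ0 (a := m - ε)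
        (fun v => by linarith [hu v]),
      eventually_le_expWeighted_ball hμ (f := fun x => Ψ (A x)) (by fun_prop) u
        (a := m + ε) (lt_add_of_pos_right m hε')] with r hr h1 h2
    refine hlε.trans_le ?_
    rw [← ofReal_exp_mul_div (measure_ball_zero_pos hμ hr).ne' (measure_ne_top _ _)]
    exact ENNReal.div_le_div h2 (iSup_le h1)
  · refine lt_of_le_of_lt ?_ hl
    exact ENNReal.div_le_of_le_mul (by rw [one_mul]; exact le_iSup (fun v =>
      (expWeighted μ fun x => Ψ (A x)) (Metric.ball v r)) (u : X))

/-- Two levels `a < a'` strictly between the functional's values at `v` and `u` keep the ratio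
eventually below `exp (a - a') < 1`. -/
lemma not_isMode_expWeighted (hμ : ∫ x, x ∂μ = 0) {f : X → ℝ} (hf : Continuous f)
    (u : X) (v : cameronMartin μ) (huv : ∀ hu : u ∈ cameronMartin μ,
      f v + cameronMartinNorm μ v ^ 2 / 2 < f u + cameronMartinNorm μ ⟨u, hu⟩ ^ 2 / 2) :
    ¬ IsMode (expWeighted μ f) u := by
  intro hmode
  obtain ⟨a', ha', hu⟩ : ∃ a', f v + cameronMartinNorm μ v ^ 2 / 2 < a' ∧
      ∀ hu : u ∈ cameronMartin μ, a' < f u + cameronMartinNorm μ ⟨u, hu⟩ ^ 2 / 2 := by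
    by_cases hu : u ∈ cameronMartin μ
    · obtain ⟨a', h1, h2⟩ := exists_between (huv hu)
      exact ⟨a', h1, fun _ => h2⟩
    · exact ⟨_, lt_add_one _, fun h => absurd h hu⟩
  obtain ⟨a, ha, haa⟩ := exists_between ha'
  have hle : (1 : ℝ≥0∞) ≤ ENNReal.ofReal (Real.exp (-a' - -a)) := by
    refine le_of_tendsto hmode ?_
    filter_upwards [self_mem_nhdsWithin, eventually_expWeighted_ball_le hμ hf u hu,
      eventually_le_expWeighted_ball hμ hf v ha] with r hr h1 h2
    rw [← ofReal_exp_mul_div (measure_ball_zero_pos hμ hr).ne' (measure_ne_top _ _)]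
    exact ENNReal.div_le_div h1
      (h2.trans (le_iSup (fun v => expWeighted μ f (Metric.ball v r)) (v : X)))
  rw [ENNReal.one_le_ofReal, Real.one_le_exp_iff] at hle
  linarith

end Mode

/-! ### Normalization, continuity of `F`, and the theorem -/

lemma integral_exp_neg_pos {X : Type*} [TopologicalSpace X] [MeasurableSpace X]
    [BorelSpace X] {μ : Measure X} [IsProbabilityMeasure μ] {f : X → ℝ} (hf : Continuous f) (hf0 : ∀ x, 0 ≤ f x) :
    0 < ∫ x, Real.exp (-f x) ∂μ := by
  refine integral_exp_pos ?_
  refine Integrable.of_bound (C := 1) (by fun_prop) (Eventually.of_forall fun x => ?_)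
  rw [Real.norm_eq_abs, Real.abs_exp, Real.exp_le_one_iff]
  linarith [hf0 x]

lemma IsLocallyLipschitz.continuous {N M : ℕ}
    {F : EuclideanSpace ℝ (Fin N) → EuclideanSpace ℝ (Fin M)} (hF : IsLocallyLipschitz F) :
    Continuous F := by
  refine continuous_iff_continuousAt.2 fun z => ?_
  obtain ⟨L, hL, h⟩ := hF (‖z‖ + 1) (by positivity)
  have hlip : LipschitzOnWith L.toNNReal F (Metric.ball 0 (‖z‖ + 1)) :=
    LipschitzOnWith.of_dist_le_mul fun x hx y hy => by
      rw [dist_eq_norm, dist_eq_norm, Real.coe_toNNReal L hL.le]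
      exact h x hx y hy
  exact hlip.continuousOn.continuousAt (Metric.isOpen_ball.mem_nhds (by simp))

end GaussianMAP
/-- `X` is a separable real Hilbert space and `μ = N(0, K)` a centered Gaussian measure on it. -/
theorem mainTheorem6 {X : Type*} [NormedAddCommGroup X] [InnerProductSpace ℝ X] [CompleteSpace X]
    [TopologicalSpace.SeparableSpace X] [MeasurableSpace X] [BorelSpace X]
    (μ : Measure X) [IsGaussian μ] (hμ : ∫ x, x ∂μ = 0)
    {N M : ℕ} (φ : Fin N → StrongDual ℝ X)
    (F : EuclideanSpace ℝ (Fin N) → EuclideanSpace ℝ (Fin M))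
    (hF : GaussianMAP.IsLocallyLipschitz F)
    (y : EuclideanSpace ℝ (Fin M)) (β : ℝ) (hβ : 0 < β) (u : X) :
    GaussianMAP.IsMode (GaussianMAP.posterior μ φ F y β) u ↔
      IsMinOn (GaussianMAP.onsagerMachlup μ φ F y β) Set.univ u := by
  have : SecondCountableTopology X := UniformSpace.secondCountable_of_separable X
  let A : X →L[ℝ] EuclideanSpace ℝ (Fin N) :=
    (EuclideanSpace.equiv (Fin N) ℝ).symm.toContinuousLinearMap ∘L ContinuousLinearMap.pi φ
  let Ψ : EuclideanSpace ℝ (Fin N) → ℝ := fun z => 1 / (2 * β ^ 2) * ‖F z - y‖ ^ 2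
  have hFc := hF.continuous
  have hΨ : Continuous Ψ := by fun_prop
  have hΨ0 : ∀ z, 0 ≤ Ψ z := fun z => by positivity
  have hobs : ∀ x, -(1 / (2 * β ^ 2)) * ‖GaussianMAP.obsMap φ F x - y‖ ^ 2 = -Ψ (A x) :=
    fun x => neg_mul _ _
  have hZ : 0 < ∫ x, Real.exp (-Ψ (A x)) ∂μ :=
    GaussianMAP.integral_exp_neg_pos (f := fun x => Ψ (A x)) (by fun_prop) fun x => hΨ0 _
  have hpost : GaussianMAP.posterior μ φ F y β
      = (ENNReal.ofReal (∫ x, Real.exp (-Ψ (A x)) ∂μ))⁻¹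
        • GaussianMAP.expWeighted μ fun x => Ψ (A x) := by
    rw [GaussianMAP.posterior, GaussianMAP.expWeighted, ← withDensity_smul _ (by fun_prop)]
    simp only [hobs]
    congr 1
    ext x
    rw [ENNReal.ofReal_div_of_pos hZ, Pi.smul_apply, smul_eq_mul, ENNReal.div_eq_inv_mul]
  have hJ : ∀ (v : X) (hv : v ∈ GaussianMAP.cameronMartin μ),
      GaussianMAP.onsagerMachlup μ φ F y β v
        = ENNReal.ofReal (Ψ (A v) + GaussianMAP.cameronMartinNorm μ ⟨v, hv⟩ ^ 2 / 2) := by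
    intro v hv
    rw [GaussianMAP.onsagerMachlup, dif_pos hv, one_div_mul_eq_div (2 : ℝ)]
    rfl
  have hJ' : ∀ v, v ∉ GaussianMAP.cameronMartin μ →
      GaussianMAP.onsagerMachlup μ φ F y β v = ⊤ := fun v hv => dif_neg hv
  have hnn : ∀ v : GaussianMAP.cameronMartin μ,
      0 ≤ Ψ (A v) + GaussianMAP.cameronMartinNorm μ v ^ 2 / 2 := fun v =>
    add_nonneg (hΨ0 _) (by positivity)
  rw [hpost, GaussianMAP.isMode_smul_iff _ (by simp) (by simpa using hZ), isMinOn_univ_iff]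
  constructor
  · intro hmode
    by_contra! h
    obtain ⟨v, hv⟩ := h
    have hvH : v ∈ GaussianMAP.cameronMartin μ := by
      by_contra hvH
      rw [hJ' v hvH] at hv
      exact not_top_lt hv
    refine GaussianMAP.not_isMode_expWeighted hμ (f := fun x => Ψ (A x)) (by fun_prop) u ⟨v, hvH⟩
      (fun hu => ?_) hmode
    rw [hJ v hvH, hJ u hu] at hv
    exact (ENNReal.ofReal_lt_ofReal_iff_of_nonneg (hnn ⟨v, hvH⟩)).1 hv
  · intro hmin
    -- The functional is finite at `0 ∈ H(μ)`, so a minimizer cannot lie outside `H(μ)`.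
    have hu : u ∈ GaussianMAP.cameronMartin μ := by
      by_contra hu
      have h0 := hmin 0
      rw [hJ' u hu, hJ 0 (Submodule.zero_mem _)] at h0
      exact ENNReal.ofReal_ne_top (top_le_iff.1 h0)
    refine GaussianMAP.isMode_expWeighted_of_forall_le hμ A hΨ hΨ0 ⟨u, hu⟩ fun v => ?_
    have h1 := hmin v
    rw [hJ u hu, hJ v v.2] at h1
    exact (ENNReal.ofReal_le_ofReal_iff (hnn v)).1 h1
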